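/- Let $\mathcal S$ be a finite field with addition $\oplus$, let $\mathcal X_1,\mathcal X_2,\mathcal Y$ be finite sets, let $W_{S_1S_2}$ be a probability mass function on $\mathcal S\times\mathcal S$, and let $W(y\mid x_1,x_2)$ be the transition probabilities of a two-user discrete memoryless multiple access channel (MAC) with input alphabets $\mathcal X_1,\mathcal X_2$ and output alphabet $\mathcal Y$, used without feedback. The pairs $(S_{1,t},S_{2,t})$, $t\in\mathbb N$, are i.i.d. with distribution $W_{S_1S_2}$. A computation code of length $n$ consists of encoders $e_j:\mathcal S^n\to\mathcal X_j^n$ ($j=1,2$) and a decoder $d:\mathcal Y^n\to\mathcal S^n$; its average error probability is $$\bar\xi(e_1,e_2,d)=\sum_{s_1^n,s_2^n\in\mathcal S^n}\ \sum_{y^n:\,d(y^n)\neq s_1^n\oplus s_2^n}\ \prod_{t=1}^n W\bigl(y_t\mid e_1(s_1^n)_t,e_2(s_2^n)_t\bigr)\prod_{t=1}^n W_{S_1S_2}(s_{1,t},s_{2,t}).$$ The sum of the sources is computable over the MAC if for every $\eta>0$ there is $N(\eta)\in\mathbb N$ such that for every $n>N(\eta)$ there is a computation code of length $n$ with $\bar\xi\le\eta$.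 Let $\mathbb D(W)$ be the set of probability mass functions $p_{V_1V_2X_1X_2Y}$ on $\mathcal S\times\mathcal S\times\mathcal X_1\times\mathcal X_2\times\mathcal Y$ such that (i) $(V_1,X_1)$ is independent of $(V_2,X_2)$, and (ii) $p_{Y\mid X_1X_2V_1V_2}=p_{Y\mid X_1X_2}=W$. Put $$\alpha(W)=\sup\bigcup_{p\in\mathbb D(W)}\bigl\{R\ge 0:\ R\le\min\{H(V_1),H(V_2)\}-H(V_1\oplus V_2\mid Y)\bigr\},$$ where all entropies are taken to the same base of logarithm. **Theorem.** If $H(S_1\oplus S_2)<\alpha(W)$, then the sum of the sources is computable over the MAC. -/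

import Mathlib

open scoped BigOperators

namespace SumMAC

open Classical in
/-- The law of the random variable `f` when the sample space carries the mass function `p`. -/
noncomputable def law {Ω A : Type*} [Fintype Ω] (p : Ω → ℝ) (f : Ω → A) : A → ℝ :=
  fun a => ∑ ω with f ω = a, p ω

/-- Shannon entropy (in nats) of the mass function `p`, with `0 log 0 = 0`. -/
noncomputable def entropy {A : Type*} [Fintype A] (p : A → ℝ) : ℝ :=
  -∑ a, p a * Real.log (p a)

/-- Conditional entropy `H(A | B)` (in nats) of the joint mass function `p` of `(A, B)`;
terms with `p (a, b) = 0` contribute `0`. -/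
noncomputable def condEntropy {A B : Type*} [Fintype A] [Fintype B] (p : A × B → ℝ) : ℝ :=
  -∑ a, ∑ b, p (a, b) * Real.log (p (a, b) / law p Prod.snd b)

section TestChannels

variable {S X₁ X₂ Y : Type*} [Fintype S] [Fintype X₁] [Fintype X₂] [Fintype Y]

/-- `p` is the joint law of `(V₁, V₂, X₁, X₂, Y)` with `(V₁, X₁)` independent of `(V₂, X₂)`, and
the conditional law of `Y` given `(V₁, V₂, X₁, X₂)` equal to `W(· | X₁, X₂)`. -/
structure IsTestChannel (W : X₁ → X₂ → Y → ℝ) (p : S × S × X₁ × X₂ × Y → ℝ) : Prop where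
  mem_stdSimplex : p ∈ stdSimplex ℝ (S × S × X₁ × X₂ × Y)
  indep : ∀ (v₁ : S) (x₁ : X₁) (v₂ : S) (x₂ : X₂),
    law p (fun (V₁, V₂, X₁, X₂, _) => (V₁, X₁, V₂, X₂)) (v₁, x₁, v₂, x₂) =
      law p (fun (V₁, _, X₁, _, _) => (V₁, X₁)) (v₁, x₁) *
      law p (fun (_, V₂, _, X₂, _) => (V₂, X₂)) (v₂, x₂)
  channel : ∀ (v₁ v₂ : S) (x₁ : X₁) (x₂ : X₂) (y : Y),
    p (v₁, v₂, x₁, x₂, y) =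
      law p (fun (V₁, V₂, X₁, X₂, _) => (V₁, V₂, X₁, X₂)) (v₁, v₂, x₁, x₂) * W x₁ x₂ y

/-- The rates `R ≥ 0` with `R ≤ min {H(V₁), H(V₂)} - H(V₁ + V₂ | Y)` under the joint law `p`. -/
def rates [Add S] (p : S × S × X₁ × X₂ × Y → ℝ) : Set ℝ :=
  {R | 0 ≤ R ∧ R ≤
    min (entropy (law p (fun (V₁, _, _, _, _) => V₁)))
        (entropy (law p (fun (_, V₂, _, _, _) => V₂)))
      - condEntropy (law p (fun (V₁, V₂, _, _, Y) => (V₁ + V₂, Y)))}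

/-- `α(W)`, for auxiliary variables `V₁, V₂` with values in `S`: the supremum of the union of all
`rates p`. For a channel with nonempty input alphabets this union contains `0` and is bounded. -/
noncomputable def alpha (S : Type*) [Fintype S] [Add S] (W : X₁ → X₂ → Y → ℝ) : ℝ :=
  sSup (⋃ p ∈ {p : S × S × X₁ × X₂ × Y → ℝ | IsTestChannel W p}, rates p)

end TestChannels

/-- A computation code of block length `n`: two encoders and a decoder. -/
structure ComputationCode (S X₁ X₂ Y : Type*) (n : ℕ) where
  enc₁ : (Fin n → S) → (Fin n → X₁)
  enc₂ : (Fin n → S) → (Fin n → X₂)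
  dec : (Fin n → Y) → (Fin n → S)

section Codes

variable {S X₁ X₂ Y : Type*} [Fintype S] [Add S] [Fintype Y]

open Classical in
/-- The average error probability of a computation code for the sum of an i.i.d. source pair with
single-letter law `WS`, over the memoryless channel `W` used without feedback. -/
noncomputable def ComputationCode.errorProb {n : ℕ} (c : ComputationCode S X₁ X₂ Y n)
    (WS : S × S → ℝ) (W : X₁ → X₂ → Y → ℝ) : ℝ :=
  ∑ s₁ : Fin n → S, ∑ s₂ : Fin n → S, ∑ y : Fin n → Y with c.dec y ≠ s₁ + s₂,
    (∏ t, W (c.enc₁ s₁ t) (c.enc₂ s₂ t) (y t)) * ∏ t, WS (s₁ t, s₂ t)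

/-- The sum of the sources is computable over the channel: for all large block lengths there are
codes of arbitrarily small average error probability. -/
def IsSumComputable (WS : S × S → ℝ) (W : X₁ → X₂ → Y → ℝ) : Prop :=
  ∀ η : ℝ, 0 < η → ∃ N : ℕ, ∀ n : ℕ, N < n →
    ∃ c : ComputationCode S X₁ X₂ Y n, c.errorProb WS W ≤ η

end Codes

end SumMAC

/-!
The codes combine linear hashing of the sum of the sources with a common linear hash of the two
auxiliary sequences. Fix a test channel with `H(S₁ + S₂) + H(V₁ + V₂ | Y) < min (H(V₁), H(V₂))` and
matrices `H, K` over the field `S` with `n` columns and `k` rows, where `k log |S| / n` lies strictly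
between the two sides. User `j` computes `cⱼ = K sⱼ + dⱼ` with a fixed shift `dⱼ`, and samples
`(vⱼ, xⱼ)` from the block law of `(Vⱼ, Xⱼ)` conditioned on `H vⱼ = cⱼ`. By linearity
`H (v₁ + v₂) - K (s₁ + s₂) = d₁ + d₂`, which the decoder knows.

* The leftover hash lemma `sum_abs_law_mulVec_sub_le`: since `k log |S| < n H(Vⱼ)`, for a suitable `H`
  the hash `H vⱼ` of a block with law `Vⱼⁿ` is nearly uniform. Uniform shifts make the `cⱼ` uniform
  and independent of the sources, so up to a small total variation distance the pairs `(vⱼ, xⱼ)` are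
  sampled from their unconditional laws, independently of each other and of the sources
  (`exists_coset_code`). Averaging fixes the shifts and makes the encoders deterministic.
* In that idealised system the decoder looks for a typical `s` and a `v` jointly typical with `y`
  such that `H v - K s = d₁ + d₂`. There are about `exp (n (H(S₁ + S₂) + H(V₁ + V₂ | Y)))` candidates,
  and a random `K` makes each wrong `s` fit with probability `|S|⁻ᵏ` (`exists_hash_decoder`).
  Only `s = s₁ + s₂` has to be correct, not `v`.

Typicality is expressed by one-sided bounds on products of probabilities, whose failure probability
vanishes by a Chernoff bound (`exists_tail_le`).
-/

namespace SumMAC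

/-! ### Laws, block laws and concentration -/

section Laws

variable {Ω A B : Type*} [Fintype Ω]

theorem law_nonneg {p : Ω → ℝ} (hp : ∀ ω, 0 ≤ p ω) (f : Ω → A) (a : A) : 0 ≤ law p f a :=
  Finset.sum_nonneg fun ω _ => hp ω

theorem le_law {p : Ω → ℝ} (hp : ∀ ω, 0 ≤ p ω) (f : Ω → A) (ω : Ω) : p ω ≤ law p f (f ω) := by
  classical
  exact Finset.single_le_sum (f := p) (fun ω _ => hp ω) (by simp)

/-- The law of a block of `n` independent letters, each with law `p`. -/
noncomputable def blockLaw (p : A → ℝ) (n : ℕ) : (Fin n → A) → ℝ := fun a => ∏ t, p (a t)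

/-- Applying `f` letter by letter turns independent letters into independent letters. -/
theorem law_blockLaw (p : Ω → ℝ) (f : Ω → A) (n : ℕ) :
    law (blockLaw p n) (fun ω t => f (ω t)) = blockLaw (law p f) n := by
  classical
  ext a
  simp only [blockLaw, law]
  rw [Finset.prod_univ_sum]
  refine Finset.sum_congr ?_ fun _ _ => rfl
  ext ω
  simp [funext_iff]

variable [Fintype A]

open Classical in
theorem sum_law_mul (p : Ω → ℝ) (f : Ω → A) (F : A → ℝ) :
    ∑ a, law p f a * F a = ∑ ω, p ω * F (f ω) := by
  rw [← Finset.sum_fiberwise Finset.univ f]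
  refine Finset.sum_congr rfl fun a _ => ?_
  rw [law, Finset.sum_mul]
  refine Finset.sum_congr rfl fun ω hω => ?_
  rw [(Finset.mem_filter.1 hω).2]

theorem sum_law (p : Ω → ℝ) (f : Ω → A) : ∑ a, law p f a = ∑ ω, p ω := by
  simpa using sum_law_mul p f fun _ => 1

theorem law_mem_stdSimplex {p : Ω → ℝ} (hp : p ∈ stdSimplex ℝ Ω) (f : Ω → A) :
    law p f ∈ stdSimplex ℝ A :=
  ⟨law_nonneg hp.1 f, (sum_law p f).trans hp.2⟩

theorem law_comp (p : Ω → ℝ) (f : Ω → A) (g : A → B) :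
    law (law p f) g = law p (fun ω => g (f ω)) := by
  classical
  ext b
  have := sum_law_mul p f (fun a => if g a = b then 1 else 0)
  simp only [mul_ite, mul_one, mul_zero] at this
  simp only [law, Finset.sum_filter] at this ⊢
  convert this

theorem blockLaw_mem_stdSimplex {p : A → ℝ} (hp : p ∈ stdSimplex ℝ A) (n : ℕ) :
    blockLaw p n ∈ stdSimplex ℝ (Fin n → A) := by
  classical
  refine ⟨fun a => Finset.prod_nonneg fun t _ => hp.1 _, ?_⟩
  simp only [blockLaw]
  rw [← Fintype.piFinset_univ, ← Finset.prod_univ_sum]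
  simp [hp.2]

/-- Chernoff bound: under a block law, the empirical sum of `g` exceeds its mean by a linear amount
with exponentially small probability. -/
theorem exists_tail_le {p : A → ℝ} (hp : p ∈ stdSimplex ℝ A) (g : A → ℝ) {ε : ℝ} (hε : 0 < ε) :
    ∃ ρ : ℝ, 0 ≤ ρ ∧ ρ < 1 ∧ ∀ n : ℕ,
      ∑ a : Fin n → A with n * (∑ x, p x * g x + ε) ≤ ∑ t, g (a t), blockLaw p n a ≤ ρ ^ n := by
  classical
  set h : A → ℝ := fun x => g x - (∑ x, p x * g x + ε) with hh
  set C : ℝ := 1 + ε + ∑ x, |h x| with hC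
  have hsum : 0 ≤ ∑ x, |h x| := Finset.sum_nonneg fun _ _ => abs_nonneg _
  have hhC (x : A) : |h x| ≤ C := by
    have : |h x| ≤ ∑ x, |h x| := Finset.single_le_sum (f := fun x => |h x|)
      (fun _ _ => abs_nonneg _) (Finset.mem_univ x)
    linarith
  have hC0 : 0 < C := by linarith
  -- The quadratic bound on `exp` is minimised near this parameter.
  set l : ℝ := ε / (2 * C ^ 2) with hl
  have hl0 : 0 < l := by positivity
  have hlC : l * C ≤ 1 := by
    rw [hl, div_mul_eq_mul_div, div_le_one (by positivity)]
    nlinarith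
  have hmean : ∑ x, p x * h x = -ε := by
    simp only [hh, mul_sub, Finset.sum_sub_distrib]
    rw [← Finset.sum_mul, hp.2]
    ring
  refine ⟨∑ x, p x * Real.exp (l * h x),
    Finset.sum_nonneg fun x _ => mul_nonneg (hp.1 x) (Real.exp_pos _).le, ?_, fun n => ?_⟩
  · have key (x : A) : p x * Real.exp (l * h x) ≤ p x + l * (p x * h x) + p x * (l * C) ^ 2 := by
      have hx : |l * h x| ≤ l * C := by
        rw [abs_mul, abs_of_pos hl0]
        exact mul_le_mul_of_nonneg_left (hhC x) hl0.le
      have h1 := (abs_le.1 (Real.abs_exp_sub_one_sub_id_le (hx.trans hlC))).2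
      have h2 : (l * h x) ^ 2 ≤ (l * C) ^ 2 := sq_le_sq' (abs_le.1 hx).1 (abs_le.1 hx).2
      nlinarith [hp.1 x]
    refine (Finset.sum_le_sum fun x _ => key x).trans_lt ?_
    rw [Finset.sum_add_distrib, Finset.sum_add_distrib, ← Finset.mul_sum, hmean, ← Finset.sum_mul,
      hp.2]
    have : l * C ^ 2 = ε / 2 := by rw [hl]; field_simp
    nlinarith [mul_pos hl0 hε]
  · have : (∑ x, p x * Real.exp (l * h x)) ^ n
        = ∑ a : Fin n → A, blockLaw p n a * Real.exp (l * ∑ t, h (a t)) := by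
      have := Finset.prod_univ_sum (fun _ : Fin n => (Finset.univ : Finset A))
        (fun _ x => p x * Real.exp (l * h x))
      simp only [Finset.prod_const, Finset.card_univ, Fintype.card_fin,
        Fintype.piFinset_univ] at this
      rw [this]
      refine Finset.sum_congr rfl fun a _ => ?_
      rw [Finset.prod_mul_distrib, Finset.mul_sum, Real.exp_sum, blockLaw]
    rw [this, Finset.sum_filter]
    refine Finset.sum_le_sum fun a _ => ?_
    have hP := (blockLaw_mem_stdSimplex hp n).1 a
    split_ifs with ha
    · refine le_mul_of_one_le_right hP (Real.one_le_exp (mul_nonneg hl0.le ?_))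
      simp only [hh, Finset.sum_sub_distrib, Finset.sum_const, Finset.card_univ, Fintype.card_fin,
        nsmul_eq_mul]
      linarith
    · exact mul_nonneg hP (Real.exp_pos _).le

open Filter Topology in
theorem tendsto_tail {p : A → ℝ} (hp : p ∈ stdSimplex ℝ A) (g : A → ℝ) {ε : ℝ} (hε : 0 < ε) :
    Tendsto (fun n : ℕ => ∑ a : Fin n → A with n * (∑ x, p x * g x + ε) ≤ ∑ t, g (a t),
      blockLaw p n a) atTop (𝓝 0) := by
  obtain ⟨ρ, h0, h1, h⟩ := exists_tail_le hp g hε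
  exact squeeze_zero (fun n => Finset.sum_nonneg fun a _ => (blockLaw_mem_stdSimplex hp n).1 a) h
    (tendsto_pow_atTop_nhds_zero_of_lt_one h0 h1)

/-- A product which is positive on the support of the block law may be replaced there by the sum of
the logarithms. -/
theorem sum_blockLaw_le_of_log {p r : A → ℝ} (hp : ∀ a, 0 ≤ p a) (hr : ∀ a, p a ≠ 0 → 0 < r a)
    {n : ℕ} {P Q : (Fin n → A) → Prop} [DecidablePred P] [DecidablePred Q]
    (h : ∀ a, (0 < ∏ t, r (a t)) → Real.log (∏ t, r (a t)) = ∑ t, Real.log (r (a t)) →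
      P a → Q a) :
    ∑ a with P a, blockLaw p n a ≤ ∑ a with Q a, blockLaw p n a := by
  classical
  rw [Finset.sum_filter, Finset.sum_filter]
  refine Finset.sum_le_sum fun a _ => ?_
  have hP : 0 ≤ blockLaw p n a := Finset.prod_nonneg fun t _ => hp _
  rcases hP.eq_or_lt with h0 | h0
  · simp [← h0]
  · have hne (t : Fin n) : 0 < r (a t) :=
      hr _ (Finset.prod_ne_zero_iff.1 h0.ne' t (Finset.mem_univ t))
    have := h a (Finset.prod_pos fun t _ => hne t) (Real.log_prod fun t _ => (hne t).ne')
    split_ifs <;> first | exact le_rfl | exact hP | (exfalso; tauto)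

open Filter Topology in
open Classical in
/-- Asymptotic equipartition, lower side. The weight `r` may be `p` itself, for the entropy, or a
conditional probability, for the conditional entropy. -/
theorem tendsto_prod_lt {p r : A → ℝ} (hp : p ∈ stdSimplex ℝ A) (hr : ∀ a, p a ≠ 0 → 0 < r a)
    {h ε : ℝ} (hh : h = -∑ a, p a * Real.log (r a)) (hε : 0 < ε) :
    Tendsto (fun n : ℕ => ∑ a : Fin n → A with ∏ t, r (a t) < Real.exp (-(n * (h + ε))),
      blockLaw p n a) atTop (𝓝 0) := by
  refine squeeze_zero (fun n => Finset.sum_nonneg fun a _ => (blockLaw_mem_stdSimplex hp n).1 a)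
    (fun n => sum_blockLaw_le_of_log hp.1 hr fun a hpos hlog ha => ?_)
    (tendsto_tail hp (fun a => -Real.log (r a)) hε)
  rw [← Real.log_lt_iff_lt_exp hpos, hlog] at ha
  simp only [mul_neg, Finset.sum_neg_distrib]
  rw [← hh]
  linarith

open Filter Topology in
open Classical in
/-- Asymptotic equipartition, upper side. -/
theorem tendsto_lt_prod {p r : A → ℝ} (hp : p ∈ stdSimplex ℝ A) (hr : ∀ a, p a ≠ 0 → 0 < r a)
    {h ε : ℝ} (hh : h = -∑ a, p a * Real.log (r a)) (hε : 0 < ε) :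
    Tendsto (fun n : ℕ => ∑ a : Fin n → A with Real.exp (-(n * (h - ε))) < ∏ t, r (a t),
      blockLaw p n a) atTop (𝓝 0) := by
  refine squeeze_zero (fun n => Finset.sum_nonneg fun a _ => (blockLaw_mem_stdSimplex hp n).1 a)
    (fun n => sum_blockLaw_le_of_log hp.1 hr fun a hpos hlog ha => ?_)
    (tendsto_tail hp (fun a => Real.log (r a)) hε)
  rw [← Real.lt_log_iff_exp_lt hpos, hlog] at ha
  have : ∑ a, p a * Real.log (r a) = -h := by rw [hh, neg_neg]
  rw [this]
  linarith

/-- A set of points of weight at least `c`, out of a total weight at most one, has at most `c⁻¹`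
elements. -/
theorem card_mul_le_one {w : A → ℝ} (hw : ∀ a, 0 ≤ w a) (hsum : ∑ a, w a ≤ 1) {c : ℝ}
    (T : Finset A) (hT : ∀ a ∈ T, c ≤ w a) : T.card * c ≤ 1 := by
  rw [← nsmul_eq_mul]
  exact (Finset.card_nsmul_le_sum T w c hT).trans
    ((Finset.sum_le_univ_sum_of_nonneg hw).trans hsum)

end Laws

/-! ### Hashing with a random matrix -/

section Hashing

open Matrix

variable {S : Type*} [Field S] [Fintype S] {k n : ℕ}

open Classical in
/-- For `w ≠ 0` the value `H w` of a uniformly distributed matrix `H` is uniformly distributed. -/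
theorem card_mulVec_eq {w : Fin n → S} (hw : w ≠ 0) (b : Fin k → S) :
    (Fintype.card S : ℝ) ^ k * ∑ H : Matrix (Fin k) (Fin n) S, (if H *ᵥ w = b then 1 else 0)
      = Fintype.card (Matrix (Fin k) (Fin n) S) := by
  obtain ⟨i, hi⟩ := Function.ne_iff.1 hw
  have hshift (c : Fin k → S) :
      ∑ H : Matrix (Fin k) (Fin n) S, (if H *ᵥ w = c then (1 : ℝ) else 0)
        = ∑ H : Matrix (Fin k) (Fin n) S, (if H *ᵥ w = b then 1 else 0) := by
    let D : Matrix (Fin k) (Fin n) S := fun r j => if j = i then (b r - c r) / w i else 0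
    have hD : D *ᵥ w = b - c := by
      ext r
      simp only [D, Matrix.mulVec, dotProduct, ite_mul, zero_mul, Finset.sum_ite_eq',
        Finset.mem_univ, if_true, Pi.sub_apply]
      exact div_mul_cancel₀ _ hi
    refine Fintype.sum_equiv (Equiv.addRight D) _ _ fun H => ?_
    simp only [Equiv.coe_addRight, Matrix.add_mulVec, hD]
    congr 1
    rw [eq_iff_iff, add_sub_left_comm, add_eq_left, sub_eq_zero]
  have htot : ∑ c : Fin k → S, ∑ H : Matrix (Fin k) (Fin n) S,
      (if H *ᵥ w = c then (1 : ℝ) else 0) = Fintype.card (Matrix (Fin k) (Fin n) S) := by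
    rw [Finset.sum_comm]
    simp
  simp only [hshift, Finset.sum_const, Finset.card_univ, nsmul_eq_mul] at htot
  rw [← htot]
  simp

open Classical in
/-- The leftover hash lemma in mean square, for a subprobability `P` bounded by `M`. -/
theorem sum_sq_law_mulVec_le {P : (Fin n → S) → ℝ} (hP : ∀ v, 0 ≤ P v) {M : ℝ}
    (hM : ∀ v, P v ≤ M) (h1 : ∑ v, P v ≤ 1) :
    ∑ H : Matrix (Fin k) (Fin n) S, ∑ c,
        (law P (H *ᵥ ·) c - (∑ v, P v) / (Fintype.card S : ℝ) ^ k) ^ 2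
      ≤ Fintype.card (Matrix (Fin k) (Fin n) S) * M := by
  set N : ℝ := (Fintype.card (Matrix (Fin k) (Fin n) S) : ℝ) with hN
  set Q : ℝ := (Fintype.card S : ℝ) ^ k with hQ
  set m : ℝ := ∑ v, P v with hm
  have hQ0 : 0 < Q := by positivity
  have hsq (H : Matrix (Fin k) (Fin n) S) :
      ∑ c, (law P (H *ᵥ ·) c - m / Q) ^ 2
        = (∑ v, ∑ v', P v * P v' * if H *ᵥ (v - v') = 0 then 1 else 0) - m ^ 2 / Q := by
    have hcard : ((Finset.univ : Finset (Fin k → S)).card : ℝ) = Q := by simp [hQ]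
    have hlaw2 : ∑ c, law P (H *ᵥ ·) c * law P (H *ᵥ ·) c
        = ∑ v, ∑ v', P v * P v' * if H *ᵥ (v - v') = 0 then 1 else 0 := by
      rw [sum_law_mul P (H *ᵥ ·) (law P (H *ᵥ ·))]
      refine Finset.sum_congr rfl fun v _ => ?_
      rw [law, Finset.mul_sum, Finset.sum_filter]
      refine Finset.sum_congr rfl fun v' _ => ?_
      simp only [Matrix.mulVec_sub, sub_eq_zero, eq_comm (a := H *ᵥ v)]
      split_ifs <;> simp
    have : ∀ c, (law P (H *ᵥ ·) c - m / Q) ^ 2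
        = law P (H *ᵥ ·) c * law P (H *ᵥ ·) c - law P (H *ᵥ ·) c * (2 * (m / Q)) + (m / Q) ^ 2 :=
      fun c => by ring
    simp only [this, Finset.sum_add_distrib, Finset.sum_sub_distrib]
    rw [hlaw2, ← Finset.sum_mul, sum_law, Finset.sum_const, nsmul_eq_mul, hcard]
    field_simp
    ring
  have hpair (v v' : Fin n → S) :
      ∑ H : Matrix (Fin k) (Fin n) S, (if H *ᵥ (v - v') = 0 then (1 : ℝ) else 0)
        ≤ N / Q + if v' = v then N else 0 := by
    by_cases hv : v' = v
    · subst hv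
      simp only [sub_self, Matrix.mulVec_zero, if_true]
      have : 0 ≤ N / Q := by positivity
      simpa [hN] using this
    · have := card_mulVec_eq (k := k) (sub_ne_zero.2 (Ne.symm hv)) 0
      rw [if_neg hv, add_zero, le_div_iff₀ hQ0, mul_comm]
      exact this.le
  simp only [hsq, Finset.sum_sub_distrib]
  have hmain : ∑ H : Matrix (Fin k) (Fin n) S,
      ∑ v, ∑ v', P v * P v' * (if H *ᵥ (v - v') = 0 then (1 : ℝ) else 0)
      ≤ m ^ 2 * (N / Q) + N * ∑ v, P v * P v := by
    rw [Finset.sum_comm]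
    have : ∀ v, ∑ H : Matrix (Fin k) (Fin n) S,
        ∑ v', P v * P v' * (if H *ᵥ (v - v') = 0 then (1 : ℝ) else 0)
        ≤ ∑ v', P v * P v' * (N / Q + if v' = v then N else 0) := by
      intro v
      rw [Finset.sum_comm]
      refine Finset.sum_le_sum fun v' _ => ?_
      rw [← Finset.mul_sum]
      exact mul_le_mul_of_nonneg_left (hpair v v') (mul_nonneg (hP _) (hP _))
    refine (Finset.sum_le_sum fun v _ => this v).trans_eq ?_
    simp only [mul_add, Finset.sum_add_distrib, mul_ite, mul_zero, Finset.sum_ite_eq',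
      Finset.mem_univ, if_true]
    rw [sq, hm, Finset.sum_mul_sum, Finset.sum_mul, Finset.mul_sum]
    congr 1
    · refine Finset.sum_congr rfl fun v _ => ?_
      rw [Finset.sum_mul]
    · exact Finset.sum_congr rfl fun v _ => mul_comm _ _
  have hdiag : ∑ v, P v * P v ≤ M := by
    have hM0 : 0 ≤ M := (hP 0).trans (hM 0)
    calc ∑ v, P v * P v ≤ ∑ v, P v * M :=
          Finset.sum_le_sum fun v _ => mul_le_mul_of_nonneg_left (hM v) (hP v)
      _ = m * M := by rw [← Finset.sum_mul]
      _ ≤ 1 * M := mul_le_mul_of_nonneg_right h1 hM0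
      _ = M := one_mul M
  have hN0 : 0 ≤ N := by positivity
  have hconst : ∑ H : Matrix (Fin k) (Fin n) S, m ^ 2 / Q = m ^ 2 * (N / Q) := by
    rw [Finset.sum_const, nsmul_eq_mul, Finset.card_univ, ← hN]
    ring
  have := mul_le_mul_of_nonneg_left hdiag hN0
  rw [hconst]
  linarith

open Classical in
/-- Leftover hash lemma: on average over a random matrix `H`, the law of `H v` is close to uniform
in total variation if `v` has a law `P` that rarely exceeds a value `M` well below `q⁻ᵏ`. -/
theorem sum_abs_law_mulVec_sub_le {P : (Fin n → S) → ℝ} (hP : P ∈ stdSimplex ℝ (Fin n → S))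
    {M : ℝ} (hM : 0 ≤ M) :
    ∑ H : Matrix (Fin k) (Fin n) S, ∑ c, |law P (H *ᵥ ·) c - ((Fintype.card S : ℝ) ^ k)⁻¹|
      ≤ Fintype.card (Matrix (Fin k) (Fin n) S) *
        (Real.sqrt ((Fintype.card S : ℝ) ^ k * M) + 2 * ∑ v with M < P v, P v) := by
  set N : ℝ := (Fintype.card (Matrix (Fin k) (Fin n) S) : ℝ) with hN
  set Q : ℝ := (Fintype.card S : ℝ) ^ k with hQ
  have hN0 : 0 ≤ N := by positivity
  have hQ0 : 0 < Q := by positivity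
  set P₁ : (Fin n → S) → ℝ := fun v => if M < P v then 0 else P v with hP₁
  set P₂ : (Fin n → S) → ℝ := fun v => if M < P v then P v else 0 with hP₂
  have hadd (v) : P v = P₁ v + P₂ v := by simp only [hP₁, hP₂]; split_ifs <;> simp
  have h1 (v) : 0 ≤ P₁ v := by simp only [hP₁]; split_ifs <;> simp [hP.1]
  have h2 (v) : 0 ≤ P₂ v := by simp only [hP₂]; split_ifs <;> simp [hP.1]
  have h1M (v) : P₁ v ≤ M := by
    simp only [hP₁]
    split_ifs with hv
    · exact hM
    · exact not_lt.1 hv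
  set δ : ℝ := ∑ v with M < P v, P v with hδ
  have hδ2 : ∑ v, P₂ v = δ := by rw [hδ, Finset.sum_filter]
  have hδ1 : ∑ v, P₁ v = 1 - δ := by
    have : ∑ v, P v = ∑ v, P₁ v + ∑ v, P₂ v := by
      rw [← Finset.sum_add_distrib]
      exact Finset.sum_congr rfl fun v _ => hadd v
    rw [hP.2, hδ2] at this
    linarith
  have hδ0 : 0 ≤ δ := hδ2 ▸ Finset.sum_nonneg fun v _ => h2 v
  have hcard : ((Finset.univ : Finset (Fin k → S)).card : ℝ) = Q := by simp [hQ]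
  have hstep (H : Matrix (Fin k) (Fin n) S) :
      ∑ c, |law P (H *ᵥ ·) c - Q⁻¹|
        ≤ ∑ c, |law P₁ (H *ᵥ ·) c - (∑ v, P₁ v) / Q| + 2 * δ := by
    have hc (c) : |law P (H *ᵥ ·) c - Q⁻¹|
        ≤ |law P₁ (H *ᵥ ·) c - (∑ v, P₁ v) / Q| + (law P₂ (H *ᵥ ·) c + δ / Q) := by
      have e : law P (H *ᵥ ·) c - Q⁻¹ = (law P₁ (H *ᵥ ·) c - (∑ v, P₁ v) / Q)
          + (law P₂ (H *ᵥ ·) c - δ / Q) := by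
        have : law P (H *ᵥ ·) c = law P₁ (H *ᵥ ·) c + law P₂ (H *ᵥ ·) c := by
          simp only [law, ← Finset.sum_add_distrib, hadd]
        rw [this, hδ1]
        field_simp
        ring
      rw [e]
      refine (abs_add_le _ _).trans (add_le_add le_rfl ((abs_sub _ _).trans ?_))
      rw [abs_of_nonneg (law_nonneg h2 _ c), abs_of_nonneg (by positivity : 0 ≤ δ / Q)]
    refine (Finset.sum_le_sum fun c _ => hc c).trans_eq ?_
    rw [Finset.sum_add_distrib, Finset.sum_add_distrib, sum_law, hδ2, Finset.sum_const,
      nsmul_eq_mul, hcard, mul_div_cancel₀ _ hQ0.ne', two_mul]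
  -- Cauchy--Schwarz over all pairs `(H, c)` reduces the rest to the mean-square bound.
  have hcs : ∑ H : Matrix (Fin k) (Fin n) S, ∑ c, |law P₁ (H *ᵥ ·) c - (∑ v, P₁ v) / Q|
      ≤ N * Real.sqrt (Q * M) := by
    rw [← Fintype.sum_prod_type' (f := fun (H : Matrix (Fin k) (Fin n) S) c =>
      |law P₁ (H *ᵥ ·) c - (∑ v, P₁ v) / Q|)]
    refine (sq_le_sq₀ (Finset.sum_nonneg fun _ _ => abs_nonneg _) (by positivity)).1 ?_
    refine sq_sum_le_card_mul_sum_sq.trans ?_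
    simp only [sq_abs]
    rw [Fintype.sum_prod_type, Finset.card_univ, Fintype.card_prod, mul_pow,
      Real.sq_sqrt (by positivity), Nat.cast_mul, ← hN]
    have hcard' : (Fintype.card (Fin k → S) : ℝ) = Q := by simp [hQ]
    rw [hcard']
    have := sum_sq_law_mulVec_le (k := k) h1 h1M (by linarith)
    calc _ ≤ N * Q * (N * M) := mul_le_mul_of_nonneg_left this (by positivity)
      _ = _ := by ring
  refine (Finset.sum_le_sum fun H _ => hstep H).trans ?_
  rw [Finset.sum_add_distrib, Finset.sum_const, nsmul_eq_mul, Finset.card_univ, ← hN, mul_add]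
  exact add_le_add hcs le_rfl

end Hashing

/-! ### Decoding from the hash -/

section Decoding

open Matrix

variable {S B : Type*} [Field S] [Fintype S] [Fintype B] {k n : ℕ}

open Classical in
/-- Slepian–Wolf type decoding. The decoder sees `y` and `h v - K s`, and looks for typical `s'` and
`v'` with the same difference. For a suitable matrix `K` it recovers `s` unless `s` or `v` is
atypical, up to an error given by the number of typical pairs: a competitor `s' ≠ s` is
compatible with the observation for a fraction `q⁻ᵏ` of all `K`. -/
theorem exists_hash_decoder {P : (Fin n → S) → ℝ} (hP : P ∈ stdSimplex ℝ (Fin n → S))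
    {R : (Fin n → S) × B → ℝ} (hR : R ∈ stdSimplex ℝ ((Fin n → S) × B))
    (h : (Fin n → S) → (Fin k → S)) (T : Finset (Fin n → S)) (U : B → Finset (Fin n → S))
    {L : ℝ} (hL : ∀ y, (T.card * (U y).card : ℝ) ≤ L) :
    ∃ (K : Matrix (Fin k) (Fin n) S) (dec : (Fin k → S) → B → (Fin n → S)),
      ∑ s, P s * ∑ z, R z * (if dec (h z.1 - K *ᵥ s) z.2 ≠ s then 1 else 0)
        ≤ ∑ s with s ∉ T, P s + ∑ z with z.1 ∉ U z.2, R z + L / (Fintype.card S : ℝ) ^ k := by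
  set N : ℝ := (Fintype.card (Matrix (Fin k) (Fin n) S) : ℝ) with hN
  set Q : ℝ := (Fintype.card S : ℝ) ^ k with hQ
  have hN0 : 0 < N := by positivity
  have hQ0 : 0 < Q := by positivity
  let dec : Matrix (Fin k) (Fin n) S → (Fin k → S) → B → (Fin n → S) := fun K b y =>
    if hex : ∃ s', s' ∈ T ∧ ∃ v' ∈ U y, h v' - K *ᵥ s' = b then hex.choose else 0
  have hdec (K : Matrix (Fin k) (Fin n) S) (s : Fin n → S) (z : (Fin n → S) × B) :
      (if dec K (h z.1 - K *ᵥ s) z.2 ≠ s then (1 : ℝ) else 0)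
        ≤ (if s ∉ T then 1 else 0) + (if z.1 ∉ U z.2 then 1 else 0)
          + ∑ s' ∈ T, ∑ v' ∈ U z.2,
            if s' ≠ s ∧ K *ᵥ (s' - s) = h v' - h z.1 then 1 else 0 := by
    have hnn : (0 : ℝ) ≤ ∑ s' ∈ T, ∑ v' ∈ U z.2,
        if s' ≠ s ∧ K *ᵥ (s' - s) = h v' - h z.1 then 1 else 0 :=
      Finset.sum_nonneg fun _ _ => Finset.sum_nonneg fun _ _ => by positivity
    by_cases hs : s ∈ T
    swap
    · rw [if_pos hs]
      split_ifs <;> linarith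
    by_cases hz : z.1 ∈ U z.2
    swap
    · rw [if_pos hz]
      split_ifs <;> linarith
    by_cases hd : dec K (h z.1 - K *ᵥ s) z.2 ≠ s
    swap
    · rw [if_neg hd]
      positivity
    have hex : ∃ s', s' ∈ T ∧ ∃ v' ∈ U z.2, h v' - K *ᵥ s' = h z.1 - K *ᵥ s :=
      ⟨s, hs, z.1, hz, rfl⟩
    have hval : dec K (h z.1 - K *ᵥ s) z.2 = hex.choose := dif_pos hex
    obtain ⟨hT, v', hv', heq⟩ := hex.choose_spec
    rw [hval] at hd
    have hone : (1 : ℝ) ≤ ∑ s' ∈ T, ∑ v' ∈ U z.2,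
        if s' ≠ s ∧ K *ᵥ (s' - s) = h v' - h z.1 then 1 else 0 := by
      refine le_trans ?_ (Finset.single_le_sum (fun _ _ => Finset.sum_nonneg fun _ _ => ?_) hT)
      · refine le_trans ?_ (Finset.single_le_sum (fun _ _ => ?_) hv')
        · rw [if_pos]
          refine ⟨hd, ?_⟩
          rw [Matrix.mulVec_sub]
          rw [sub_eq_sub_iff_add_eq_add] at heq ⊢
          rw [add_comm, ← heq, add_comm]
        · positivity
      · positivity
    rw [if_neg (not_not.2 hs), if_neg (not_not.2 hz)]
    split_ifs <;> linarith
  have havg (s : Fin n → S) (z : (Fin n → S) × B) :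
      ∑ K, (if dec K (h z.1 - K *ᵥ s) z.2 ≠ s then (1 : ℝ) else 0)
        ≤ N * ((if s ∉ T then 1 else 0) + (if z.1 ∉ U z.2 then 1 else 0) + L / Q) := by
    refine (Finset.sum_le_sum fun K _ => hdec K s z).trans ?_
    rw [Finset.sum_add_distrib, mul_add, Finset.sum_const, Finset.card_univ, nsmul_eq_mul, ← hN]
    gcongr
    rw [Finset.sum_comm]
    have : ∀ s' ∈ T, ∑ K : Matrix (Fin k) (Fin n) S, ∑ v' ∈ U z.2,
        (if s' ≠ s ∧ K *ᵥ (s' - s) = h v' - h z.1 then (1 : ℝ) else 0)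
        ≤ (U z.2).card * (N / Q) := by
      intro s' _
      rw [Finset.sum_comm, ← nsmul_eq_mul]
      refine Finset.sum_le_card_nsmul _ _ _ fun v' _ => ?_
      by_cases hss : s' = s
      · simp only [hss, ne_eq, not_true_eq_false, false_and, if_false, Finset.sum_const_zero]
        positivity
      · have := card_mulVec_eq (k := k) (sub_ne_zero.2 hss) (h v' - h z.1)
        simp only [ne_eq, hss, not_false_eq_true, true_and]
        rw [le_div_iff₀ hQ0, mul_comm]
        exact this.le
    refine (Finset.sum_le_card_nsmul _ _ _ this).trans ?_
    rw [nsmul_eq_mul, ← mul_assoc]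
    calc _ ≤ L * (N / Q) := mul_le_mul_of_nonneg_right (hL z.2) (by positivity)
      _ = _ := by ring
  set E : ℝ := ∑ s with s ∉ T, P s + ∑ z with z.1 ∉ U z.2, R z + L / Q with hE
  have htotal : ∑ K, ∑ s, P s * ∑ z, R z *
      (if dec K (h z.1 - K *ᵥ s) z.2 ≠ s then (1 : ℝ) else 0) ≤ ∑ _K : Matrix (Fin k) (Fin n) S, E := by
    calc _ = ∑ s, P s * ∑ z, R z *
          ∑ K, (if dec K (h z.1 - K *ᵥ s) z.2 ≠ s then (1 : ℝ) else 0) := by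
          rw [Finset.sum_comm]
          refine Finset.sum_congr rfl fun s _ => ?_
          rw [← Finset.mul_sum, Finset.sum_comm]
          simp only [Finset.mul_sum]
      _ ≤ ∑ s, P s * ∑ z, R z *
          (N * ((if s ∉ T then 1 else 0) + (if z.1 ∉ U z.2 then 1 else 0) + L / Q)) :=
          Finset.sum_le_sum fun s _ => mul_le_mul_of_nonneg_left
            (Finset.sum_le_sum fun z _ => mul_le_mul_of_nonneg_left (havg s z) (hR.1 z)) (hP.1 s)
      _ = ∑ s, P s * (N * ((if s ∉ T then 1 else 0) + ∑ z with z.1 ∉ U z.2, R z + L / Q)) := by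
          refine Finset.sum_congr rfl fun s _ => ?_
          congr 1
          simp only [mul_add, Finset.sum_add_distrib, ← Finset.sum_mul, hR.2, one_mul]
          congr 2
          rw [Finset.sum_filter, Finset.mul_sum]
          refine Finset.sum_congr rfl fun z _ => ?_
          split_ifs <;> ring
      _ = N * E := by
          simp only [mul_add, Finset.sum_add_distrib, ← Finset.sum_mul, hP.2, one_mul, hE]
          congr 2
          rw [Finset.sum_filter, Finset.mul_sum]
          refine Finset.sum_congr rfl fun z _ => ?_
          split_ifs <;> ring
      _ = _ := by simp [hN]
  obtain ⟨K, -, hK⟩ := Finset.exists_le_of_sum_le Finset.univ_nonempty htotal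
  exact ⟨K, dec K, hK⟩

end Decoding

/-! ### Encoding by sampling from a coset -/

section Encoding

theorem exists_le_of_weighted_sum {Ω : Type*} [Fintype Ω] {r : Ω → ℝ} (hr : r ∈ stdSimplex ℝ Ω)
    (f : Ω → ℝ) : ∃ ω, f ω ≤ ∑ ω, r ω * f ω := by
  by_contra! hlt
  have hne : ∃ ω ∈ Finset.univ, 0 < r ω := by
    refine (Finset.sum_pos_iff_of_nonneg fun ω _ => hr.1 ω).1 ?_
    rw [hr.2]
    exact one_pos
  obtain ⟨ω₀, -, h₀⟩ := hne
  have : ∑ ω, r ω * ∑ ω', r ω' * f ω' < ∑ ω, r ω * f ω :=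
    Finset.sum_lt_sum (fun ω _ => mul_le_mul_of_nonneg_left (hlt ω).le (hr.1 ω))
      ⟨ω₀, Finset.mem_univ _, mul_lt_mul_of_pos_left (hlt ω₀) h₀⟩
  rw [← Finset.sum_mul, hr.2, one_mul] at this
  exact lt_irrefl _ this

/-- Random encoders can be replaced by deterministic ones without increasing an expected cost. -/
theorem exists_deterministic_encoders {A₁ A₂ Ω₁ Ω₂ : Type*} [Fintype A₁] [Fintype A₂]
    [Fintype Ω₁] [Fintype Ω₂] {r₁ : A₁ → Ω₁ → ℝ} {r₂ : A₂ → Ω₂ → ℝ}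
    (h₁ : ∀ s, r₁ s ∈ stdSimplex ℝ Ω₁) (h₂ : ∀ s, r₂ s ∈ stdSimplex ℝ Ω₂)
    (F : A₁ → A₂ → Ω₁ → Ω₂ → ℝ) :
    ∃ (φ₁ : A₁ → Ω₁) (φ₂ : A₂ → Ω₂), ∑ s₁, ∑ s₂, F s₁ s₂ (φ₁ s₁) (φ₂ s₂)
      ≤ ∑ s₁, ∑ s₂, ∑ ω₁, r₁ s₁ ω₁ * ∑ ω₂, r₂ s₂ ω₂ * F s₁ s₂ ω₁ ω₂ := by
  choose φ₁ hφ₁ using fun s₁ => exists_le_of_weighted_sum (h₁ s₁)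
    fun ω₁ => ∑ s₂, ∑ ω₂, r₂ s₂ ω₂ * F s₁ s₂ ω₁ ω₂
  choose φ₂ hφ₂ using fun s₂ => exists_le_of_weighted_sum (h₂ s₂)
    fun ω₂ => ∑ s₁, F s₁ s₂ (φ₁ s₁) ω₂
  refine ⟨φ₁, φ₂, ?_⟩
  calc ∑ s₁, ∑ s₂, F s₁ s₂ (φ₁ s₁) (φ₂ s₂)
      = ∑ s₂, ∑ s₁, F s₁ s₂ (φ₁ s₁) (φ₂ s₂) := Finset.sum_comm
    _ ≤ ∑ s₂, ∑ ω₂, r₂ s₂ ω₂ * ∑ s₁, F s₁ s₂ (φ₁ s₁) ω₂ :=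
        Finset.sum_le_sum fun s₂ _ => hφ₂ s₂
    _ = ∑ s₁, ∑ s₂, ∑ ω₂, r₂ s₂ ω₂ * F s₁ s₂ (φ₁ s₁) ω₂ := by
        refine Eq.trans (Finset.sum_congr rfl fun s₂ _ => ?_) Finset.sum_comm
        simp only [Finset.mul_sum]
        exact Finset.sum_comm
    _ ≤ ∑ s₁, ∑ ω₁, r₁ s₁ ω₁ * ∑ s₂, ∑ ω₂, r₂ s₂ ω₂ * F s₁ s₂ ω₁ ω₂ :=
        Finset.sum_le_sum fun s₁ _ => hφ₁ s₁
    _ = _ := by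
        refine Finset.sum_congr rfl fun s₁ _ => ?_
        rw [Finset.sum_comm]
        simp only [Finset.mul_sum]

open Classical in
/-- The conditional law of a sample given the value `c` of a statistic `f`. Where that value has
probability zero, the unconditional law is used, so that this is always a probability. -/
noncomputable def condLaw {Ω C : Type*} [Fintype Ω] (P : Ω → ℝ) (f : Ω → C) (c : C) : Ω → ℝ :=
  fun ω => if law P f c = 0 then P ω else (if f ω = c then P ω else 0) / law P f c

theorem condLaw_mem_stdSimplex {Ω C : Type*} [Fintype Ω] {P : Ω → ℝ} (hP : P ∈ stdSimplex ℝ Ω)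
    [Fintype C] (f : Ω → C) (c : C) : condLaw P f c ∈ stdSimplex ℝ Ω := by
  classical
  by_cases h0 : law P f c = 0
  · have : condLaw P f c = P := by ext ω; simp [condLaw, h0]
    rwa [this]
  · refine ⟨fun ω => ?_, ?_⟩
    · simp only [condLaw, if_neg h0]
      refine div_nonneg ?_ (law_nonneg hP.1 f c)
      split_ifs <;> simp [hP.1]
    · simp only [condLaw, if_neg h0]
      rw [← Finset.sum_div, div_eq_one_iff_eq h0, law, Finset.sum_filter]

open Classical in
theorem law_mul_condLaw {Ω C : Type*} [Fintype Ω] {P : Ω → ℝ} (hP : P ∈ stdSimplex ℝ Ω)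
    [Fintype C] (f : Ω → C) (c : C) (ω : Ω) :
    law P f c * condLaw P f c ω = if f ω = c then P ω else 0 := by
  by_cases h0 : law P f c = 0
  · rw [h0, zero_mul]
    split_ifs with h
    · exact le_antisymm (hP.1 ω) (((le_law hP.1 f ω).trans_eq (by rw [h])).trans h0.le)
    · rfl
  · simp only [condLaw, if_neg h0]
    exact mul_div_cancel₀ _ h0

/-- The total variation distance between product laws is at most the sum of those of the factors. -/
theorem sum_abs_mul_sub_mul_le {C : Type*} [Fintype C] {u μ₁ μ₂ : C → ℝ}
    (hu : u ∈ stdSimplex ℝ C) (h₂ : μ₂ ∈ stdSimplex ℝ C) :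
    ∑ c₁, ∑ c₂, |u c₁ * u c₂ - μ₁ c₁ * μ₂ c₂|
      ≤ ∑ c, |μ₁ c - u c| + ∑ c, |μ₂ c - u c| := by
  have key (c₁ c₂ : C) : |u c₁ * u c₂ - μ₁ c₁ * μ₂ c₂|
      ≤ |μ₁ c₁ - u c₁| * μ₂ c₂ + u c₁ * |μ₂ c₂ - u c₂| := by
    have e : u c₁ * u c₂ - μ₁ c₁ * μ₂ c₂
        = -((μ₁ c₁ - u c₁) * μ₂ c₂) + -(u c₁ * (μ₂ c₂ - u c₂)) := by ring
    rw [e]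
    refine (abs_add_le _ _).trans_eq ?_
    rw [abs_neg, abs_neg, abs_mul, abs_mul, abs_of_nonneg (h₂.1 c₂), abs_of_nonneg (hu.1 c₁)]
  refine (Finset.sum_le_sum fun c₁ _ => Finset.sum_le_sum fun c₂ _ => key c₁ c₂).trans_eq ?_
  simp only [Finset.sum_add_distrib, ← Finset.mul_sum, h₂.2, mul_one, ← Finset.sum_mul, hu.2,
    one_mul]

open Classical in
/-- One-shot coding by coset sampling. User `j` sees `sⱼ` and samples `ωⱼ` from the conditional law
of `Pⱼ` given `fⱼ ωⱼ = K sⱼ + dⱼ`. If `d₁, d₂` are uniform, so are the two conditioning values,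
independently of the sources; when the laws of `fⱼ` are close to uniform, the error is therefore
close to that of a system in which `ω₁, ω₂` are sampled from `P₁, P₂` independently of the sources
and the decoder is told `f₁ ω₁ + f₂ ω₂ - K (s₁ + s₂)`. -/
theorem exists_coset_code {A C Z₁ Z₂ B Ω₁ Ω₂ : Type*} [Fintype A] [AddCommGroup A]
    [Fintype C] [AddCommGroup C] [Fintype B] [Fintype Ω₁] [Fintype Ω₂]
    {PS : A → A → ℝ} (hPS : ∀ s₁ s₂, 0 ≤ PS s₁ s₂) (hPS1 : ∑ s₁, ∑ s₂, PS s₁ s₂ = 1)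
    {K : A → C} (hK : ∀ s t, K (s + t) = K s + K t)
    {P₁ : Ω₁ → ℝ} (hP₁ : P₁ ∈ stdSimplex ℝ Ω₁) {P₂ : Ω₂ → ℝ} (hP₂ : P₂ ∈ stdSimplex ℝ Ω₂)
    (f₁ : Ω₁ → C) (f₂ : Ω₂ → C) (z₁ : Ω₁ → Z₁) (z₂ : Ω₂ → Z₂)
    {W : Z₁ → Z₂ → B → ℝ} (hW : ∀ a b, W a b ∈ stdSimplex ℝ B) (dec : C → B → A) :
    ∃ (e₁ : A → Z₁) (e₂ : A → Z₂) (d : C),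
      ∑ s₁, ∑ s₂, PS s₁ s₂ * ∑ y with dec d y ≠ s₁ + s₂, W (e₁ s₁) (e₂ s₂) y
        ≤ ∑ c, |law P₁ f₁ c - (Fintype.card C : ℝ)⁻¹| + ∑ c, |law P₂ f₂ c - (Fintype.card C : ℝ)⁻¹|
          + ∑ s₁, ∑ s₂, PS s₁ s₂ * ∑ ω₁, ∑ ω₂, P₁ ω₁ * P₂ ω₂ *
            ∑ y with dec (f₁ ω₁ + f₂ ω₂ - K (s₁ + s₂)) y ≠ s₁ + s₂, W (z₁ ω₁) (z₂ ω₂) y := by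
  set u : ℝ := (Fintype.card C : ℝ)⁻¹ with hu
  have hcard : (Fintype.card C : ℝ) ≠ 0 := by exact_mod_cast Fintype.card_ne_zero
  have huS : (fun _ : C => u) ∈ stdSimplex ℝ C := by
    refine ⟨fun _ => by positivity, ?_⟩
    rw [Finset.sum_const, nsmul_eq_mul, Finset.card_univ, hu, mul_inv_cancel₀ hcard]
  set Δ : ℝ := ∑ c, |law P₁ f₁ c - u| + ∑ c, |law P₂ f₂ c - u|
  set g : C → A → Ω₁ → Ω₂ → ℝ := fun b s ω₁ ω₂ =>
    ∑ y with dec b y ≠ s, W (z₁ ω₁) (z₂ ω₂) y with hg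
  have hg0 (b s ω₁ ω₂) : 0 ≤ g b s ω₁ ω₂ := Finset.sum_nonneg fun y _ => (hW _ _).1 y
  have hg1 (b s ω₁ ω₂) : g b s ω₁ ω₂ ≤ 1 := by
    rw [← (hW (z₁ ω₁) (z₂ ω₂)).2]
    exact Finset.sum_le_univ_sum_of_nonneg (hW _ _).1
  have hr₁ := condLaw_mem_stdSimplex hP₁ f₁
  have hr₂ := condLaw_mem_stdSimplex hP₂ f₂
  set r₁ := condLaw P₁ f₁
  set r₂ := condLaw P₂ f₂
  -- the error given the sources and the conditioning values
  set J : A → C → C → ℝ := fun s c₁ c₂ =>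
    ∑ ω₁, r₁ c₁ ω₁ * ∑ ω₂, r₂ c₂ ω₂ * g (c₁ + c₂ - K s) s ω₁ ω₂ with hJ
  have hJ0 (s c₁ c₂) : 0 ≤ J s c₁ c₂ :=
    Finset.sum_nonneg fun ω₁ _ => mul_nonneg ((hr₁ _).1 _)
      (Finset.sum_nonneg fun ω₂ _ => mul_nonneg ((hr₂ _).1 _) (hg0 _ _ _ _))
  have hJ1 (s c₁ c₂) : J s c₁ c₂ ≤ 1 := by
    calc J s c₁ c₂ ≤ ∑ ω₁, r₁ c₁ ω₁ * ∑ ω₂, r₂ c₂ ω₂ * 1 :=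
          Finset.sum_le_sum fun ω₁ _ => mul_le_mul_of_nonneg_left
            (Finset.sum_le_sum fun ω₂ _ => mul_le_mul_of_nonneg_left (hg1 _ _ _ _) ((hr₂ _).1 _))
            ((hr₁ _).1 _)
      _ = 1 := by simp only [mul_one, (hr₂ _).2, (hr₁ _).2]
  set I : A → ℝ := fun s => ∑ ω₁, ∑ ω₂, P₁ ω₁ * P₂ ω₂ * g (f₁ ω₁ + f₂ ω₂ - K s) s ω₁ ω₂ with hI
  have hideal (s : A) : ∑ c₁, ∑ c₂, law P₁ f₁ c₁ * law P₂ f₂ c₂ * J s c₁ c₂ = I s := by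
    have e (c₁ c₂) : law P₁ f₁ c₁ * law P₂ f₂ c₂ * J s c₁ c₂ = ∑ ω₁, ∑ ω₂,
        (if f₁ ω₁ = c₁ then P₁ ω₁ else 0) * ((if f₂ ω₂ = c₂ then P₂ ω₂ else 0)
          * g (c₁ + c₂ - K s) s ω₁ ω₂) := by
      simp only [hJ, Finset.mul_sum]
      refine Finset.sum_congr rfl fun ω₁ _ => Finset.sum_congr rfl fun ω₂ _ => ?_
      rw [← law_mul_condLaw hP₁, ← law_mul_condLaw hP₂]
      ring
    simp only [e]
    calc _ = ∑ c₁, ∑ ω₁, ∑ ω₂, ∑ c₂, (if f₁ ω₁ = c₁ then P₁ ω₁ else 0) *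
          ((if f₂ ω₂ = c₂ then P₂ ω₂ else 0) * g (c₁ + c₂ - K s) s ω₁ ω₂) := by
          refine Finset.sum_congr rfl fun c₁ _ => ?_
          rw [Finset.sum_comm]
          exact Finset.sum_congr rfl fun ω₁ _ => Finset.sum_comm
      _ = ∑ c₁, ∑ ω₁, ∑ ω₂, (if f₁ ω₁ = c₁ then P₁ ω₁ else 0) *
          (P₂ ω₂ * g (c₁ + f₂ ω₂ - K s) s ω₁ ω₂) := by
          refine Finset.sum_congr rfl fun c₁ _ => Finset.sum_congr rfl fun ω₁ _ =>
            Finset.sum_congr rfl fun ω₂ _ => ?_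
          rw [← Finset.mul_sum]
          simp only [ite_mul, zero_mul, Finset.sum_ite_eq, Finset.mem_univ, if_true]
      _ = ∑ ω₁, ∑ ω₂, ∑ c₁, (if f₁ ω₁ = c₁ then P₁ ω₁ else 0) *
          (P₂ ω₂ * g (c₁ + f₂ ω₂ - K s) s ω₁ ω₂) := by
          rw [Finset.sum_comm]
          exact Finset.sum_congr rfl fun ω₁ _ => Finset.sum_comm
      _ = I s := by
          simp only [ite_mul, zero_mul, Finset.sum_ite_eq, Finset.mem_univ, if_true, hI, mul_assoc]
  have hunif (s : A) : ∑ c₁, ∑ c₂, u * u * J s c₁ c₂ ≤ Δ + I s := by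
    rw [← hideal s]
    have hΔle := sum_abs_mul_sub_mul_le huS (law_mem_stdSimplex hP₂ f₂) (μ₁ := law P₁ f₁)
    refine le_trans ?_ (add_le_add hΔle le_rfl)
    simp only [← Finset.sum_add_distrib]
    refine Finset.sum_le_sum fun c₁ _ => Finset.sum_le_sum fun c₂ _ => ?_
    have h1 := le_abs_self (u * u - law P₁ f₁ c₁ * law P₂ f₂ c₂)
    have h2 := abs_nonneg (u * u - law P₁ f₁ c₁ * law P₂ f₂ c₂)
    nlinarith [hJ0 s c₁ c₂, hJ1 s c₁ c₂, mul_le_of_le_one_right h2 (hJ1 s c₁ c₂),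
      mul_le_mul_of_nonneg_right h1 (hJ0 s c₁ c₂)]
  -- the uniform shifts make the conditioning values uniform
  have hshift (s₁ s₂ : A) : ∑ d₁, ∑ d₂, J (s₁ + s₂) (K s₁ + d₁) (K s₂ + d₂)
      = ∑ c₁, ∑ c₂, J (s₁ + s₂) c₁ c₂ := by
    rw [← Equiv.sum_comp (Equiv.addLeft (K s₁)) fun c₁ => ∑ c₂, J (s₁ + s₂) c₁ c₂]
    refine Finset.sum_congr rfl fun d₁ _ => ?_
    exact Equiv.sum_comp (Equiv.addLeft (K s₂)) fun c₂ => J (s₁ + s₂) (K s₁ + d₁) c₂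
  have havg : ∑ d : C × C, u * u *
      (∑ s₁, ∑ s₂, PS s₁ s₂ * J (s₁ + s₂) (K s₁ + d.1) (K s₂ + d.2))
        ≤ Δ + ∑ s₁, ∑ s₂, PS s₁ s₂ * I (s₁ + s₂) := by
    calc _ = ∑ s₁, ∑ s₂, PS s₁ s₂ * ∑ c₁, ∑ c₂, u * u * J (s₁ + s₂) c₁ c₂ := by
          simp only [← Finset.mul_sum]
          simp only [← hshift]
          simp only [Finset.mul_sum, Fintype.sum_prod_type]
          rw [Finset.sum_congr rfl fun d₁ _ => Finset.sum_comm, Finset.sum_comm]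
          refine Finset.sum_congr rfl fun s₁ _ => ?_
          rw [Finset.sum_congr rfl fun d₁ _ => Finset.sum_comm, Finset.sum_comm]
          refine Finset.sum_congr rfl fun s₂ _ => Finset.sum_congr rfl fun d₁ _ =>
            Finset.sum_congr rfl fun d₂ _ => ?_
          ring
      _ ≤ ∑ s₁, ∑ s₂, PS s₁ s₂ * (Δ + I (s₁ + s₂)) :=
          Finset.sum_le_sum fun s₁ _ => Finset.sum_le_sum fun s₂ _ =>
            mul_le_mul_of_nonneg_left (hunif _) (hPS _ _)
      _ = _ := by
          simp only [mul_add, Finset.sum_add_distrib, ← Finset.sum_mul, hPS1, one_mul]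
  have huu : (fun _ : C × C => u * u) ∈ stdSimplex ℝ (C × C) := by
    refine ⟨fun _ => by positivity, ?_⟩
    rw [Fintype.sum_prod_type]
    simp only [← Finset.mul_sum, huS.2, mul_one]
  obtain ⟨⟨d₁, d₂⟩, hd⟩ := exists_le_of_weighted_sum huu
    fun d : C × C => ∑ s₁, ∑ s₂, PS s₁ s₂ * J (s₁ + s₂) (K s₁ + d.1) (K s₂ + d.2)
  obtain ⟨φ₁, φ₂, hφ⟩ := exists_deterministic_encoders (fun s₁ => hr₁ (K s₁ + d₁))
    (fun s₂ => hr₂ (K s₂ + d₂)) fun s₁ s₂ ω₁ ω₂ => PS s₁ s₂ * g (d₁ + d₂) (s₁ + s₂) ω₁ ω₂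
  refine ⟨fun s => z₁ (φ₁ s), fun s => z₂ (φ₂ s), d₁ + d₂, hφ.trans (le_trans ?_ (hd.trans havg))⟩
  refine le_of_eq (Finset.sum_congr rfl fun s₁ _ => Finset.sum_congr rfl fun s₂ _ => ?_)
  have hd12 : K s₁ + d₁ + (K s₂ + d₂) - K (s₁ + s₂) = d₁ + d₂ := by rw [hK]; abel
  simp only [hJ, hd12, Finset.mul_sum]
  refine Finset.sum_congr rfl fun ω₁ _ => Finset.sum_congr rfl fun ω₂ _ => ?_
  ring

end Encoding

/-! ### Block codes from a test channel -/

section Blocks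

theorem law_apply_of_injective {Ω A : Type*} [Fintype Ω] (p : Ω → ℝ) {e : Ω → A}
    (he : Function.Injective e) (ω : Ω) : law p e (e ω) = p ω := by
  classical
  simp [law, Finset.sum_filter, he.eq_iff]

/-- Summing over two blocks is summing over blocks of pairs. -/
theorem sum_zip {A B : Type*} [Fintype A] [Fintype B] {n : ℕ} (F : (Fin n → A × B) → ℝ) :
    ∑ a : Fin n → A, ∑ b : Fin n → B, F (fun t => (a t, b t)) = ∑ c, F c := by
  rw [← Fintype.sum_prod_type' (f := fun (a : Fin n → A) (b : Fin n → B) => F fun t => (a t, b t))]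
  exact (Equiv.sum_comp (Equiv.arrowProdEquivProdArrow (Fin n) (fun _ => A) (fun _ => B)).symm F)

variable {S X₁ X₂ Y : Type*} [Fintype S] [Fintype X₁] [Fintype X₂] [Fintype Y]

/-- A test channel is the product of the laws of `(V₁, X₁)` and `(V₂, X₂)` and the channel. -/
theorem IsTestChannel.apply_eq {W : X₁ → X₂ → Y → ℝ} {p : S × S × X₁ × X₂ × Y → ℝ}
    (hp : IsTestChannel W p) (a : S × X₁) (b : S × X₂) (y : Y) :
    p (a.1, b.1, a.2, b.2, y) = law p (fun ω => (ω.1, ω.2.2.1)) a *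
      law p (fun ω => (ω.2.1, ω.2.2.2.1)) b * W a.2 b.2 y := by
  rw [hp.channel]
  congr 1
  refine Eq.trans ?_ (hp.indep a.1 a.2 b.1 b.2)
  have h := law_comp p (fun ω => (ω.1, ω.2.2.1, ω.2.1, ω.2.2.2.1))
    (fun q : S × X₁ × S × X₂ => (q.1, q.2.2.1, q.2.1, q.2.2.2))
  have hinj : Function.Injective
      (fun q : S × X₁ × S × X₂ => (q.1, q.2.2.1, q.2.1, q.2.2.2)) := by
    rintro ⟨a, b, c, d⟩ ⟨a', b', c', d'⟩ h
    simp only [Prod.mk.injEq] at h ⊢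
    tauto
  refine (congrFun h (a.1, b.1, a.2, b.2)).symm.trans ?_
  exact law_apply_of_injective _ hinj (a.1, a.2, b.1, b.2)

/-- Sampling the two users' blocks independently and passing them through the channel realises the
block law of `(V₁ + V₂, Y)`. -/
theorem IsTestChannel.sum_blocks [Add S] {W : X₁ → X₂ → Y → ℝ} {p : S × S × X₁ × X₂ × Y → ℝ}
    (hp : IsTestChannel W p) {n : ℕ} (F : (Fin n → S) → (Fin n → Y) → ℝ) :
    ∑ ω₁ : Fin n → S × X₁, ∑ ω₂ : Fin n → S × X₂,
        blockLaw (law p fun ω => (ω.1, ω.2.2.1)) n ω₁ *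
        blockLaw (law p fun ω => (ω.2.1, ω.2.2.2.1)) n ω₂ *
        ∑ y : Fin n → Y, (∏ t, W (ω₁ t).2 (ω₂ t).2 (y t)) *
          F (fun t => (ω₁ t).1 + (ω₂ t).1) y
      = ∑ z : (Fin n → S) × (Fin n → Y),
        blockLaw (law p fun ω => (ω.1 + ω.2.1, ω.2.2.2.2)) n (fun t => (z.1 t, z.2 t)) *
          F z.1 z.2 := by
  let e : S × S × X₁ × X₂ × Y → (S × X₁) × (S × X₂) × Y :=
    fun ω => ((ω.1, ω.2.2.1), (ω.2.1, ω.2.2.2.1), ω.2.2.2.2)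
  let g : (S × X₁) × (S × X₂) × Y → S × Y := fun q => (q.1.1 + q.2.1.1, q.2.2)
  have he : Function.Injective e := by
    rintro ⟨a, b, c, d, f⟩ ⟨a', b', c', d', f'⟩ h
    simp only [e, Prod.mk.injEq] at h ⊢
    tauto
  have hlaw : law p (fun ω => (ω.1 + ω.2.1, ω.2.2.2.2)) = law (law p e) g := (law_comp p e g).symm
  have hpt (q : (S × X₁) × (S × X₂) × Y) : law p e q = law p (fun ω => (ω.1, ω.2.2.1)) q.1 *
      law p (fun ω => (ω.2.1, ω.2.2.2.1)) q.2.1 * W q.1.2 q.2.1.2 q.2.2 :=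
    (law_apply_of_injective p he (q.1.1, q.2.1.1, q.1.2, q.2.1.2, q.2.2)).trans
      (hp.apply_eq q.1 q.2.1 q.2.2)
  rw [hlaw, ← law_blockLaw (law p e) g, Fintype.sum_prod_type]
  have h1 := sum_zip (n := n) fun c : Fin n → S × Y =>
    law (blockLaw (law p e) n) (fun ω t => g (ω t)) c * F (fun t => (c t).1) (fun t => (c t).2)
  refine Eq.trans ?_ h1.symm
  rw [sum_law_mul]
  set G : (Fin n → (S × X₁) × (S × X₂) × Y) → ℝ := fun c => blockLaw (law p e) n c *
    F (fun t => (g (c t)).1) (fun t => (g (c t)).2) with hG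
  refine Eq.trans ?_ (sum_zip G)
  refine Finset.sum_congr rfl fun ω₁ _ => Eq.trans ?_ (sum_zip fun b => G fun t => (ω₁ t, b t))
  refine Finset.sum_congr rfl fun ω₂ _ => ?_
  rw [Finset.mul_sum]
  refine Finset.sum_congr rfl fun y _ => ?_
  simp only [blockLaw, hpt, Finset.prod_mul_distrib, g, hG]
  ring

open Classical in
/-- A code of length `n` built from hashes of length `k`, with a bound on its error. The sets `T` and `U y` are
the candidates the decoder considers for the sum of the sources and for `V₁ + V₂`; the values
`M₁, M₂` are the typical probabilities of `V₁` and `V₂`. -/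
theorem exists_computationCode [Field S] {WS : S × S → ℝ} (hWS : WS ∈ stdSimplex ℝ (S × S))
    {W : X₁ → X₂ → Y → ℝ} (hW : ∀ x₁ x₂, W x₁ x₂ ∈ stdSimplex ℝ Y)
    {p : S × S × X₁ × X₂ × Y → ℝ} (hp : IsTestChannel W p) (n k : ℕ)
    (T : Finset (Fin n → S)) (U : (Fin n → Y) → Finset (Fin n → S))
    {L M₁ M₂ : ℝ} (hL : ∀ y, (T.card * (U y).card : ℝ) ≤ L) (hM₁ : 0 ≤ M₁) (hM₂ : 0 ≤ M₂) :
    ∃ c : ComputationCode S X₁ X₂ Y n, c.errorProb WS W ≤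
      (Real.sqrt ((Fintype.card S : ℝ) ^ k * M₁)
        + 2 * ∑ v with M₁ < blockLaw (law p fun ω => ω.1) n v, blockLaw (law p fun ω => ω.1) n v)
      + (Real.sqrt ((Fintype.card S : ℝ) ^ k * M₂)
        + 2 * ∑ v with M₂ < blockLaw (law p fun ω => ω.2.1) n v,
          blockLaw (law p fun ω => ω.2.1) n v)
      + (∑ s with s ∉ T, blockLaw (law WS fun s => s.1 + s.2) n s
        + ∑ z : (Fin n → S) × (Fin n → Y) with z.1 ∉ U z.2,
          blockLaw (law p fun ω => (ω.1 + ω.2.1, ω.2.2.2.2)) n (fun t => (z.1 t, z.2 t))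
        + L / (Fintype.card S : ℝ) ^ k) := by
  have hP₁ := blockLaw_mem_stdSimplex (law_mem_stdSimplex hp.mem_stdSimplex fun ω => ω.1) n
  have hP₂ := blockLaw_mem_stdSimplex (law_mem_stdSimplex hp.mem_stdSimplex fun ω => ω.2.1) n
  obtain ⟨H, hH⟩ : ∃ H : Matrix (Fin k) (Fin n) S,
      ∑ c, |law (blockLaw (law p fun ω => ω.1) n) (H.mulVec ·) c - ((Fintype.card S : ℝ) ^ k)⁻¹|
      + ∑ c, |law (blockLaw (law p fun ω => ω.2.1) n) (H.mulVec ·) c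
        - ((Fintype.card S : ℝ) ^ k)⁻¹| ≤ _ := by
    have h₁ := sum_abs_law_mulVec_sub_le (k := k) hP₁ hM₁
    have h₂ := sum_abs_law_mulVec_sub_le (k := k) hP₂ hM₂
    have h := add_le_add h₁ h₂
    have hconst (b : ℝ) : Fintype.card (Matrix (Fin k) (Fin n) S) * b
        = ∑ _H : Matrix (Fin k) (Fin n) S, b := by
      rw [Finset.sum_const, Finset.card_univ, nsmul_eq_mul]
    rw [← Finset.sum_add_distrib, ← mul_add, hconst] at h
    obtain ⟨H, -, hH⟩ := Finset.exists_le_of_sum_le Finset.univ_nonempty h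
    exact ⟨H, hH⟩
  have hR : (fun z : (Fin n → S) × (Fin n → Y) =>
      blockLaw (law p fun ω => (ω.1 + ω.2.1, ω.2.2.2.2)) n (fun t => (z.1 t, z.2 t)))
      ∈ stdSimplex ℝ ((Fin n → S) × (Fin n → Y)) := by
    have hr := blockLaw_mem_stdSimplex
      (law_mem_stdSimplex hp.mem_stdSimplex fun ω => (ω.1 + ω.2.1, ω.2.2.2.2)) n
    refine ⟨fun z => hr.1 _, ?_⟩
    rw [Fintype.sum_prod_type]
    exact (sum_zip _).trans hr.2
  obtain ⟨K, dec, hdec⟩ := exists_hash_decoder (k := k)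
    (blockLaw_mem_stdSimplex (law_mem_stdSimplex hWS fun s => s.1 + s.2) n) hR
    (fun v => H.mulVec v) T U hL
  have hWSn := blockLaw_mem_stdSimplex hWS n
  obtain ⟨e₁, e₂, d, hcode⟩ := exists_coset_code
    (PS := fun s₁ s₂ : Fin n → S => blockLaw WS n fun t => (s₁ t, s₂ t))
    (fun _ _ => hWSn.1 _) ((sum_zip _).trans hWSn.2) (K := fun s => K.mulVec s)
    (fun s t => Matrix.mulVec_add K s t)
    (blockLaw_mem_stdSimplex (law_mem_stdSimplex hp.mem_stdSimplex fun ω => (ω.1, ω.2.2.1)) n)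
    (blockLaw_mem_stdSimplex (law_mem_stdSimplex hp.mem_stdSimplex fun ω => (ω.2.1, ω.2.2.2.1)) n)
    (fun ω₁ => H.mulVec fun t => (ω₁ t).1) (fun ω₂ => H.mulVec fun t => (ω₂ t).1)
    (fun ω₁ t => (ω₁ t).2) (fun ω₂ t => (ω₂ t).2)
    (W := fun x₁ x₂ y => ∏ t, W (x₁ t) (x₂ t) (y t)) (fun x₁ x₂ => by
      refine ⟨fun y => Finset.prod_nonneg fun t _ => (hW _ _).1 _, ?_⟩
      rw [← Fintype.piFinset_univ, ← Finset.prod_univ_sum]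
      simp [(hW _ _).2]) dec
  have hcard : (Fintype.card (Fin k → S) : ℝ) = (Fintype.card S : ℝ) ^ k := by simp
  have hlaw₁ : law (blockLaw (law p fun ω => (ω.1, ω.2.2.1)) n)
      (fun ω₁ => H.mulVec fun t => (ω₁ t).1)
      = law (blockLaw (law p fun ω => ω.1) n) (H.mulVec ·) := by
    rw [← law_comp p (fun ω => (ω.1, ω.2.2.1)) Prod.fst, ← law_blockLaw (law p _) Prod.fst,
      law_comp]
  have hlaw₂ : law (blockLaw (law p fun ω => (ω.2.1, ω.2.2.2.1)) n)
      (fun ω₂ => H.mulVec fun t => (ω₂ t).1)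
      = law (blockLaw (law p fun ω => ω.2.1) n) (H.mulVec ·) := by
    rw [← law_comp p (fun ω => (ω.2.1, ω.2.2.2.1)) Prod.fst, ← law_blockLaw (law p _) Prod.fst,
      law_comp]
  rw [hcard, hlaw₁, hlaw₂] at hcode
  refine ⟨⟨e₁, e₂, dec d⟩, le_trans (le_of_eq ?_) (hcode.trans (add_le_add hH ?_))⟩
  · simp only [ComputationCode.errorProb, blockLaw]
    refine Finset.sum_congr rfl fun s₁ _ => Finset.sum_congr rfl fun s₂ _ => ?_
    rw [← Finset.sum_mul, mul_comm]
    exact congrArg _ (Finset.sum_congr (by ext; simp only [Finset.mem_filter]) fun _ _ => rfl)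
  · refine le_trans (le_of_eq ?_) hdec
    have hinner (s : Fin n → S) := hp.sum_blocks (n := n) fun v y =>
      if dec (H.mulVec v - K.mulVec s) y ≠ s then 1 else 0
    have hs : ∀ s : Fin n → S, ∑ ω₁ : Fin n → S × X₁, ∑ ω₂ : Fin n → S × X₂,
        blockLaw (law p fun ω => (ω.1, ω.2.2.1)) n ω₁ *
        blockLaw (law p fun ω => (ω.2.1, ω.2.2.2.1)) n ω₂ *
        ∑ y : Fin n → Y with dec (H.mulVec (fun t => (ω₁ t).1) + H.mulVec (fun t => (ω₂ t).1)
          - K.mulVec s) y ≠ s, ∏ t, W (ω₁ t).2 (ω₂ t).2 (y t)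
        = ∑ z : (Fin n → S) × (Fin n → Y),
          blockLaw (law p fun ω => (ω.1 + ω.2.1, ω.2.2.2.2)) n (fun t => (z.1 t, z.2 t)) *
          if dec (H.mulVec z.1 - K.mulVec s) z.2 ≠ s then 1 else 0 := by
      intro s
      rw [← hinner s]
      refine Finset.sum_congr rfl fun ω₁ _ => Finset.sum_congr rfl fun ω₂ _ => ?_
      congr 1
      rw [← Matrix.mulVec_add, Finset.sum_filter]
      refine Finset.sum_congr rfl fun y _ => ?_
      rw [mul_ite, mul_one, mul_zero]
      rfl
    rw [← law_blockLaw WS, sum_law_mul, ← sum_zip]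
    refine Finset.sum_congr rfl fun s₁ _ => Finset.sum_congr rfl fun s₂ _ => congrArg _ ?_
    convert hs (s₁ + s₂) <;> rfl

end Blocks

/-! ### Choice of the hash length -/

section Asymptotics

theorem le_one_of_mem_stdSimplex {A : Type*} [Fintype A] {p : A → ℝ} (hp : p ∈ stdSimplex ℝ A)
    (a : A) : p a ≤ 1 :=
  hp.2 ▸ Finset.single_le_sum (fun a _ => hp.1 a) (Finset.mem_univ a)

theorem entropy_nonneg {A : Type*} [Fintype A] {p : A → ℝ} (hp : p ∈ stdSimplex ℝ A) :
    0 ≤ entropy p :=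
  neg_nonneg.2 <| Finset.sum_nonpos fun a _ => mul_nonpos_of_nonneg_of_nonpos (hp.1 a)
    (Real.log_nonpos (hp.1 a) (le_one_of_mem_stdSimplex hp a))

theorem condEntropy_nonneg {A B : Type*} [Fintype A] [Fintype B] {p : A × B → ℝ}
    (hp : ∀ z, 0 ≤ p z) : 0 ≤ condEntropy p :=
  neg_nonneg.2 <| Finset.sum_nonpos fun a _ => Finset.sum_nonpos fun b _ =>
    mul_nonpos_of_nonneg_of_nonpos (hp _)
      (Real.log_nonpos (div_nonneg (hp _) (law_nonneg hp _ _))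
        (div_le_one_of_le₀ (le_law hp Prod.snd (a, b)) (law_nonneg hp _ _)))

/-- For each `y` the conditional probabilities given `y` have total weight at most one; the total is
zero rather than one where a letter of `y` has probability zero. -/
theorem sum_prod_cond_le_one {A B : Type*} [Fintype A] [Fintype B] {p : A × B → ℝ} {n : ℕ}
    (y : Fin n → B) : ∑ v : Fin n → A, ∏ t, p (v t, y t) / law p Prod.snd (y t) ≤ 1 := by
  classical
  have h := Finset.prod_univ_sum (fun _ : Fin n => (Finset.univ : Finset A))
    fun t x => p (x, y t) / law p Prod.snd (y t)
  rw [Fintype.piFinset_univ] at h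
  rw [← h]
  have hone (b : B) : ∑ x, p (x, b) / law p Prod.snd b = law p Prod.snd b / law p Prod.snd b := by
    rw [← Finset.sum_div]
    congr 1
    rw [law, Finset.sum_filter, Fintype.sum_prod_type]
    simp
  simp only [hone]
  refine Finset.prod_le_one (fun t _ => ?_) fun t _ => div_self_le_one _
  rcases eq_or_ne (law p Prod.snd (y t)) 0 with h0 | h0 <;> simp [h0]

/-- Hash lengths growing at rate `a` nats per letter. -/
theorem exists_hash_length {q a : ℝ} (hq : 1 < q) (ha : 0 ≤ a) (n : ℕ) :
    ∃ k : ℕ, Real.exp (n * a) ≤ q ^ k ∧ q ^ k ≤ q * Real.exp (n * a) := by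
  have hlog := Real.log_pos hq
  have hq0 : 0 < q := by linarith
  have hx : 0 ≤ n * a / Real.log q := by positivity
  refine ⟨⌈n * a / Real.log q⌉₊, ?_, ?_⟩
  · rw [← Real.le_log_iff_exp_le (by positivity), Real.log_pow, ← div_le_iff₀ hlog]
    exact Nat.le_ceil _
  · rw [← Real.log_le_log_iff (by positivity) (by positivity), Real.log_pow,
      Real.log_mul hq0.ne' (Real.exp_ne_zero _), Real.log_exp]
    have := (Nat.ceil_lt_add_one hx).le
    have := mul_le_mul_of_nonneg_right this hlog.le
    rw [add_mul, div_mul_cancel₀ _ hlog.ne'] at this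
    linarith

theorem pos_of_mem_stdSimplex {A : Type*} [Fintype A] {p : A → ℝ} (hp : p ∈ stdSimplex ℝ A)
    (a : A) (h : p a ≠ 0) : 0 < p a :=
  (hp.1 a).lt_of_ne' h

variable {S X₁ X₂ Y : Type*} [Fintype S] [Fintype X₁] [Fintype X₂] [Fintype Y]

/-- A value below `α(W)` is below the rate bound of some test channel. An empty union or an
unbounded one would give the junk value `α(W) = 0`, which no entropy lies below. -/
theorem exists_testChannel_of_lt_alpha [Add S] {W : X₁ → X₂ → Y → ℝ} {h : ℝ} (h0 : 0 ≤ h)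
    (hlt : h < alpha S W) : ∃ p : S × S × X₁ × X₂ × Y → ℝ, IsTestChannel W p ∧
      h < min (entropy (law p fun ω => ω.1)) (entropy (law p fun ω => ω.2.1))
        - condEntropy (law p fun ω => (ω.1 + ω.2.1, ω.2.2.2.2)) := by
  rw [alpha] at hlt
  have hne : (⋃ p ∈ {p : S × S × X₁ × X₂ × Y → ℝ | IsTestChannel W p}, rates p).Nonempty := by
    by_contra hne
    rw [Set.not_nonempty_iff_eq_empty.1 hne, Real.sSup_empty] at hlt
    linarith
  obtain ⟨R, hR, hhR⟩ := exists_lt_of_lt_csSup hne hlt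
  simp only [Set.mem_iUnion] at hR
  obtain ⟨p, hp, hR⟩ := hR
  exact ⟨p, hp, hhR.trans_le hR.2⟩

open Filter Topology in
/-- Hashes of `a = H(S₁ + S₂) + H(V₁ + V₂ | Y) + 3ε` nats per letter are long enough for decoding and
short enough to be nearly uniform under both `V₁` and `V₂`. -/
theorem isSumComputable_of_testChannel [Field S] {WS : S × S → ℝ}
    (hWS : WS ∈ stdSimplex ℝ (S × S)) {W : X₁ → X₂ → Y → ℝ}
    (hW : ∀ x₁ x₂, W x₁ x₂ ∈ stdSimplex ℝ Y) {p : S × S × X₁ × X₂ × Y → ℝ}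
    (hp : IsTestChannel W p)
    (h : entropy (law WS fun s => s.1 + s.2) <
      min (entropy (law p fun ω => ω.1)) (entropy (law p fun ω => ω.2.1))
        - condEntropy (law p fun ω => (ω.1 + ω.2.1, ω.2.2.2.2))) :
    IsSumComputable WS W := by
  classical
  have hσ := law_mem_stdSimplex hWS fun s => s.1 + s.2
  have h₁ := law_mem_stdSimplex hp.mem_stdSimplex fun ω => ω.1
  have h₂ := law_mem_stdSimplex hp.mem_stdSimplex fun ω => ω.2.1
  have hr := law_mem_stdSimplex hp.mem_stdSimplex fun ω => (ω.1 + ω.2.1, ω.2.2.2.2)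
  set σ := law WS fun s => s.1 + s.2 with hσdef
  set p₁ := law p fun ω => ω.1 with hp₁
  set p₂ := law p fun ω => ω.2.1 with hp₂
  set r := law p fun ω => (ω.1 + ω.2.1, ω.2.2.2.2) with hrdef
  set q : ℝ := (Fintype.card S : ℝ) with hq
  have hq1 : 1 < q := Nat.one_lt_cast.2 Fintype.one_lt_card
  have hq0 : 0 < q := by linarith
  -- Room for one `ε` in each typicality estimate, and one for the decay of the error.
  obtain ⟨ε, hε, hε₁, hε₂⟩ : ∃ ε : ℝ, 0 < ε ∧
      entropy σ + condEntropy r + 3 * ε ≤ entropy p₁ - 2 * ε ∧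
      entropy σ + condEntropy r + 3 * ε ≤ entropy p₂ - 2 * ε := by
    refine ⟨(min (entropy p₁) (entropy p₂) - condEntropy r - entropy σ) / 5, by linarith, ?_, ?_⟩
    · linarith [min_le_left (entropy p₁) (entropy p₂)]
    · linarith [min_le_right (entropy p₁) (entropy p₂)]
  set a : ℝ := entropy σ + condEntropy r + 3 * ε with ha
  have ha0 : 0 ≤ a := by
    have := entropy_nonneg hσ
    have := condEntropy_nonneg hr.1
    positivity
  set w : S × Y → ℝ := fun z => r z / law r Prod.snd z.2 with hw
  have hwpos (z) (hz : r z ≠ 0) : 0 < w z :=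
    div_pos (pos_of_mem_stdSimplex hr z hz) ((pos_of_mem_stdSimplex hr z hz).trans_le (le_law hr.1 Prod.snd z))
  have hcond : condEntropy r = -∑ z, r z * Real.log (w z) := by
    rw [condEntropy, Fintype.sum_prod_type]
  have hsrc := tendsto_prod_lt hσ (pos_of_mem_stdSimplex hσ) rfl hε
  have hout := tendsto_prod_lt hr hwpos hcond hε
  have hin₁ := tendsto_lt_prod h₁ (pos_of_mem_stdSimplex h₁) rfl hε
  have hin₂ := tendsto_lt_prod h₂ (pos_of_mem_stdSimplex h₂) rfl hε
  have hdecay : Tendsto (fun n : ℕ => Real.exp (-(n * ε))) atTop (𝓝 0) :=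
    Real.tendsto_exp_neg_atTop_nhds_zero.comp
      (tendsto_natCast_atTop_atTop.atTop_mul_const hε)
  have hsqrt : Tendsto (fun n : ℕ => Real.sqrt (q * Real.exp (-(n * ε)))) atTop (𝓝 0) := by
    simpa using (hdecay.const_mul q).sqrt
  have hbound := ((hsqrt.add (hin₁.const_mul 2)).add (hsqrt.add (hin₂.const_mul 2))).add
    ((hsrc.add hout).add hdecay)
  simp only [mul_zero, add_zero] at hbound
  intro η hη
  obtain ⟨N, hN⟩ := eventually_atTop.1 (hbound.eventually (gt_mem_nhds hη))
  refine ⟨N, fun n hn => ?_⟩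
  obtain ⟨k, hk₁, hk₂⟩ := exists_hash_length hq1 ha0 n
  set T : Finset (Fin n → S) := {s | Real.exp (-(n * (entropy σ + ε))) ≤ ∏ t, σ (s t)} with hTdef
  set U : (Fin n → Y) → Finset (Fin n → S) := fun y =>
    {v | Real.exp (-(n * (condEntropy r + ε))) ≤ ∏ t, w (v t, y t)} with hUdef
  have hTU (y : Fin n → Y) : (T.card * (U y).card : ℝ)
      ≤ Real.exp (n * (entropy σ + ε)) * Real.exp (n * (condEntropy r + ε)) := by
    have hT := card_mul_le_one (blockLaw_mem_stdSimplex hσ n).1 (blockLaw_mem_stdSimplex hσ n).2.le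
      T fun s hs => (Finset.mem_filter.1 hs).2
    have hU := card_mul_le_one (w := fun v : Fin n → S => ∏ t, w (v t, y t))
      (fun v => Finset.prod_nonneg fun t _ => div_nonneg (hr.1 _) (law_nonneg hr.1 _ _))
      (sum_prod_cond_le_one y) (U y) fun v hv => (Finset.mem_filter.1 hv).2
    rw [Real.exp_neg, ← div_eq_mul_inv, div_le_one (Real.exp_pos _)] at hT hU
    exact mul_le_mul hT hU (Nat.cast_nonneg _) (Real.exp_pos _).le
  obtain ⟨c, hc⟩ := exists_computationCode hWS hW hp n k T U hTU
    (Real.exp_pos (-(n * (entropy p₁ - ε)))).le (Real.exp_pos (-(n * (entropy p₂ - ε)))).le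
  refine ⟨c, hc.trans (le_trans ?_ (hN n hn.le).le)⟩
  have hM {M : ℝ} (hM : a ≤ M - 2 * ε) :
      Real.sqrt (q ^ k * Real.exp (-(n * (M - ε)))) ≤ Real.sqrt (q * Real.exp (-(n * ε))) := by
    refine Real.sqrt_le_sqrt ((mul_le_mul_of_nonneg_right hk₂ (Real.exp_pos _).le).trans ?_)
    rw [mul_assoc, ← Real.exp_add]
    refine mul_le_mul_of_nonneg_left (Real.exp_le_exp.2 ?_) hq0.le
    have := mul_le_mul_of_nonneg_left hM (Nat.cast_nonneg (α := ℝ) n)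
    linarith
  have hL : Real.exp (n * (entropy σ + ε)) * Real.exp (n * (condEntropy r + ε)) / q ^ k
      ≤ Real.exp (-(n * ε)) := by
    rw [div_le_iff₀ (by positivity), ← Real.exp_add]
    refine le_trans (le_of_eq ?_) (mul_le_mul_of_nonneg_left hk₁ (Real.exp_pos _).le)
    rw [← Real.exp_add, ha]
    ring_nf
  have hout' : ∑ z : (Fin n → S) × (Fin n → Y) with z.1 ∉ U z.2,
      blockLaw r n (fun t => (z.1 t, z.2 t))
      = ∑ b : Fin n → S × Y with ∏ t, w (b t) < Real.exp (-(n * (condEntropy r + ε))),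
        blockLaw r n b := by
    rw [Finset.sum_filter, Finset.sum_filter, Fintype.sum_prod_type, ← sum_zip]
    simp only [hUdef, Finset.mem_filter, Finset.mem_univ, true_and, not_le]
  have hsrc' : ∑ s with s ∉ T, blockLaw σ n s
      = ∑ s : Fin n → S with ∏ t, σ (s t) < Real.exp (-(n * (entropy σ + ε))),
        blockLaw σ n s := by
    simp only [hTdef, Finset.mem_filter, Finset.mem_univ, true_and, not_le]
  rw [hout', hsrc']
  exact add_le_add (add_le_add (add_le_add (hM hε₁) le_rfl) (add_le_add (hM hε₂) le_rfl))
    (add_le_add le_rfl hL)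

end Asymptotics
end SumMAC

theorem theorem1 {S X₁ X₂ Y : Type*} [Field S] [Fintype S] [Fintype X₁] [Fintype X₂] [Fintype Y]
    (WS : S × S → ℝ) (hWS : WS ∈ stdSimplex ℝ (S × S))
    (W : X₁ → X₂ → Y → ℝ) (hW : ∀ x₁ x₂, W x₁ x₂ ∈ stdSimplex ℝ Y)
    (h : SumMAC.entropy (SumMAC.law WS (fun s => s.1 + s.2)) < SumMAC.alpha S W) :
    SumMAC.IsSumComputable WS W := by
  obtain ⟨p, hp, hlt⟩ := SumMAC.exists_testChannel_of_lt_alpha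
    (SumMAC.entropy_nonneg (SumMAC.law_mem_stdSimplex hWS _)) h
  exact SumMAC.isSumComputable_of_testChannel hWS hW hp hlt
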